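/- Let $T$ be a tree on $n$ vertices with root $x$. Its bottleneck matrix $M$ is the inverse of the matrix obtained as follows: attach a new pendent vertex $v$ to $x$, form the Laplacian matrix of the resulting tree, and delete the row and column of $v$. The path matrix $N$ of $(T,x)$ is the $(0,1)$-matrix whose $(i,j)$ entry is $1$ if and only if $i$ lies on the path from $j$ to $x$, and $NN^T$ is the neckbottle matrix of $(T,x)$. Write $\rho(A)$ for the spectral radius of a real square matrix $A$, and $c_3(A,\mathbf 1)=\dfrac{\mathbf 1^TA^3\mathbf 1}{\mathbf 1^TA^2\mathbf 1}$, where $\mathbf 1$ is the all-ones vector. For integers $d\ge 1$ and $r\ge 0$ let $B_1(d,r)$ be the rooted tree formed from a path on $d$ vertices by adding $r$ pendent vertices to an end-vertex of the path, this end-vertex being the root; let $M_1$ and $Q_1$ be the bottleneck matrix and the neckbottle matrix of $B_1(d,r)$. Let $$\begin{aligned} U_1(d,r)={}&4r^3+2(d^2+3d+4)r^2+\tfrac1{12}(13d^4+26d^3+41d^2+28d+48)r\\&+\tfrac1{2520}d(d+1)(2d+1)(68d^4+136d^3+133d^2+65d+18),\\ U_2(d,r)={}&4r^2+2(d^2+d+2)r+\tfrac1{30}d(d+1)(2d+1)(2d^2+2d+1),\\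 V_1(d,r)={}&r^4+(4d+3)r^3+\tfrac12(2d+3)(d+2)(d+1)r^2\\&+\tfrac1{15}(d+1)(4d^4+16d^3+19d^2+21d+15)r\\&+\tfrac1{2520}d(2d+1)(d+1)(68d^4+136d^3+133d^2+65d+18),\\ V_2(d,r)={}&r^3+(3d+2)r^2+\tfrac13(d+1)(2d^2+4d+3)r+\tfrac1{30}d(2d+1)(d+1)(2d^2+2d+1). \end{aligned}$$ (1) Let $T$ be a tree on $n$ vertices, rooted at a vertex of eccentricity $d\ge 1$ (the largest number of edges on a path starting at the root), let $M$ be its bottleneck matrix, and let $r=n-d$. Then, for the matrices $Q_1,M_1$ of $B_1(d,r)$, $c_3(Q_1,\mathbf 1)<\rho(M)$ and $c_3(M_1,\mathbf 1)<\rho(M)$. (2) For all integers $d,r\ge 1$: $\rho(M_1)=\rho(Q_1)$, $c_3(Q_1,\mathbf 1)=\dfrac{U_1(d,r)}{U_2(d,r)}$ and $c_3(M_1,\mathbf 1)=\dfrac{V_1(d,r)}{V_2(d,r)}$. (3) For each integer $d\ge 3$ there is a real number $r_0\in(0.4d^2-1,\ 0.42d^2+2)$ which is the only positive real root of $\dfrac{V_1(d,r)}{V_2(d,r)}-\dfrac{U_1(d,r)}{U_2(d,r)}$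 as a function of $r$; this function is negative for $0<r<r_0$ and positive for $r>r_0$. In particular, for positive integers $r$, $c_3(M_1,\mathbf 1)<c_3(Q_1,\mathbf 1)$ if $r<r_0$, and $c_3(M_1,\mathbf 1)>c_3(Q_1,\mathbf 1)$ if $r>r_0$. -/

import Mathlib

namespace RootedTreeBounds

noncomputable section

/-- The Perron value of a real square matrix: its spectral radius, that is, the largest modulus of
its complex eigenvalues. -/
def perronValue {n : Type*} [Fintype n] [DecidableEq n] (A : Matrix n n ℝ) : ℝ :=
  (spectralRadius ℂ (A.map (fun a : ℝ => (a : ℂ)))).toReal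

/-- `c_k(A, x) = (xᵀ A ^ k x) / (xᵀ A ^ (k - 1) x)`, for `k ≥ 1`. -/
def cSeq {n : Type*} [Fintype n] [DecidableEq n] (k : ℕ) (A : Matrix n n ℝ) (x : n → ℝ) : ℝ :=
  (x ⬝ᵥ ((A ^ k).mulVec x)) / (x ⬝ᵥ ((A ^ (k - 1)).mulVec x))

open Classical in
/-- The bottleneck matrix of a graph at a vertex `v`: the inverse of the matrix obtained from the
Laplacian matrix by deleting the row and the column of `v`. -/
def bottleneckAt {W : Type*} [Fintype W] [DecidableEq W] (G : SimpleGraph W) (v : W) :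
    Matrix {w : W // w ≠ v} {w : W // w ≠ v} ℝ :=
  ((G.lapMatrix ℝ).submatrix Subtype.val Subtype.val)⁻¹

/-- The graph obtained from `G` by adding a new pendent vertex `none`, joined to `x` only. -/
def addPendent {V : Type*} (G : SimpleGraph V) (x : V) : SimpleGraph (Option V) where
  Adj
    | some a, some b => G.Adj a b
    | some a, none => a = x
    | none, some b => b = x
    | none, none => False
  symm := ⟨by
    rintro (_ | a) (_ | b) h
    · exact h
    · exact h
    · exact h
    · exact SimpleGraph.Adj.symm h⟩
  loopless := ⟨by
    rintro (_ | a) h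
    · exact h
    · exact G.loopless.irrefl a h⟩

/-- The bottleneck matrix of a tree `G` rooted at `x`: attach a new pendent vertex to the root and
take the bottleneck matrix at the new vertex. It is indexed by the vertices of `G`. -/
def bottleneckMatrix {V : Type*} [Fintype V] [DecidableEq V] (G : SimpleGraph V) (x : V) :
    Matrix V V ℝ :=
  (bottleneckAt (addPendent G x) none).submatrix
    (fun a => ⟨some a, Option.some_ne_none a⟩) (fun a => ⟨some a, Option.some_ne_none a⟩)

open Classical in
/-- The path matrix of a tree `G` rooted at `x`: the `(i, j)` entry is `1` if `i` lies on the path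
from `j` to `x`, and `0` otherwise. -/
def pathMatrix {V : Type*} (G : SimpleGraph V) (x : V) : Matrix V V ℝ :=
  Matrix.of fun i j => if ∃ p : G.Walk j x, p.IsPath ∧ i ∈ p.support then 1 else 0

/-- The neckbottle matrix `N Nᵀ` of a rooted tree with path matrix `N`. -/
def neckbottleMatrix {V : Type*} [Fintype V] (G : SimpleGraph V) (x : V) : Matrix V V ℝ :=
  pathMatrix G x * (pathMatrix G x).transpose

/-- The broom `B(d, r)`: a path on the `d` vertices `inl 0, …, inl (d - 1)`, with `r` pendent
vertices `inr k` attached to the end-vertex `inl 0`. -/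
def broom (d r : ℕ) : SimpleGraph (Fin d ⊕ Fin r) :=
  SimpleGraph.fromRel fun
    | Sum.inl i, Sum.inl j => i.val + 1 = j.val
    | Sum.inl i, Sum.inr _ => i.val = 0
    | Sum.inr _, _ => False

/-- The root of `B₁(d, r)`: the end-vertex of the path that carries the pendent vertices. -/
def broomRoot (d r : ℕ) (hd : 0 < d) : Fin d ⊕ Fin r := Sum.inl ⟨0, hd⟩

/-- The bottleneck matrix `M₁` of the rooted broom `B₁(d, r)`. -/
def broomM (d r : ℕ) (hd : 0 < d) : Matrix (Fin d ⊕ Fin r) (Fin d ⊕ Fin r) ℝ :=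
  bottleneckMatrix (broom d r) (broomRoot d r hd)

/-- The neckbottle matrix `Q₁` of the rooted broom `B₁(d, r)`. -/
def broomQ (d r : ℕ) (hd : 0 < d) : Matrix (Fin d ⊕ Fin r) (Fin d ⊕ Fin r) ℝ :=
  neckbottleMatrix (broom d r) (broomRoot d r hd)

def U₁ (d r : ℝ) : ℝ :=
  4 * r ^ 3 + 2 * (d ^ 2 + 3 * d + 4) * r ^ 2
    + 1 / 12 * (13 * d ^ 4 + 26 * d ^ 3 + 41 * d ^ 2 + 28 * d + 48) * r
    + 1 / 2520 * d * (d + 1) * (2 * d + 1)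
      * (68 * d ^ 4 + 136 * d ^ 3 + 133 * d ^ 2 + 65 * d + 18)

def U₂ (d r : ℝ) : ℝ :=
  4 * r ^ 2 + 2 * (d ^ 2 + d + 2) * r
    + 1 / 30 * d * (d + 1) * (2 * d + 1) * (2 * d ^ 2 + 2 * d + 1)

def V₁ (d r : ℝ) : ℝ :=
  r ^ 4 + (4 * d + 3) * r ^ 3 + 1 / 2 * (2 * d + 3) * (d + 2) * (d + 1) * r ^ 2
    + 1 / 15 * (d + 1) * (4 * d ^ 4 + 16 * d ^ 3 + 19 * d ^ 2 + 21 * d + 15) * r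
    + 1 / 2520 * d * (2 * d + 1) * (d + 1)
      * (68 * d ^ 4 + 136 * d ^ 3 + 133 * d ^ 2 + 65 * d + 18)

def V₂ (d r : ℝ) : ℝ :=
  r ^ 3 + (3 * d + 2) * r ^ 2 + 1 / 3 * (d + 1) * (2 * d ^ 2 + 4 * d + 3) * r
    + 1 / 30 * d * (2 * d + 1) * (d + 1) * (2 * d ^ 2 + 2 * d + 1)

end

end RootedTreeBounds

open RootedTreeBounds

/-! For symmetric invertible `A`, the number `c₃(A, 1)` is the Rayleigh quotient of `A` at `A1`. It
lies strictly below the spectral radius unless `A1` is an eigenvector for it, and invertibility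
would then make `1` one as well (`cSeq_three_lt_perronValue`).

In a rooted tree each column of the path matrix `N` is the parent's column plus a unit vector, so
`N⁻¹ = 1 - P` with `P` the parent matrix. The Laplacian with the pendent vertex deleted is `(1 -
P)(1 - P)ᵀ`, whence `M = NᵀN` (`IsParentMap.bottleneckMatrix_eq`). As `Q = NNᵀ` has the same
characteristic polynomial, the spectral radii agree.

A longest path from the root embeds the broom's vertices into the tree so that its path matrix is
entrywise at most `N`. Since the spectral radius is monotone on nonnegative symmetric matrices, the
broom bounds the tree from below (`perronValue_broomM_le`). The quotients for the broom reduce to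
power sums, and `V₁U₂ - U₁V₂` is `r` times a cubic in `r` with a single positive root. -/

namespace RootedTreeBounds

open Matrix Polynomial

/-! ### Spectral radius of real symmetric matrices -/

section Perron

variable {n : Type*} [Fintype n] [DecidableEq n] {A B : Matrix n n ℝ}

/-- The characteristic polynomial already splits over `ℝ`, so passing to `ℂ` adds no eigenvalue. -/
lemma spectrum_map_eq (hA : A.IsHermitian) :
    spectrum ℂ (A.map (fun a : ℝ => (a : ℂ))) = Set.range fun i => (hA.eigenvalues i : ℂ) := by
  ext μ
  rw [Matrix.mem_spectrum_iff_isRoot_charpoly]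
  have h : (A.map (fun a : ℝ => (a : ℂ))).charpoly = A.charpoly.map Complex.ofRealHom :=
    Matrix.charpoly_map A Complex.ofRealHom
  rw [h, hA.charpoly_eq, Polynomial.map_prod, Polynomial.IsRoot.def, Polynomial.eval_prod,
    Finset.prod_eq_zero_iff]
  simp only [Finset.mem_univ, true_and, Polynomial.map_sub, Polynomial.map_X, Polynomial.map_C,
    Polynomial.eval_sub, Polynomial.eval_X, Polynomial.eval_C, sub_eq_zero, Set.mem_range]
  exact exists_congr fun _ => eq_comm

lemma perronValue_eq_of_charpoly_eq (h : A.charpoly = B.charpoly) :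
    perronValue A = perronValue B := by
  have hs : spectrum ℂ (A.map (fun a : ℝ => (a : ℂ)))
      = spectrum ℂ (B.map (fun a : ℝ => (a : ℂ))) := by
    ext μ
    rw [Matrix.mem_spectrum_iff_isRoot_charpoly, Matrix.mem_spectrum_iff_isRoot_charpoly]
    have hA : (A.map (fun a : ℝ => (a : ℂ))).charpoly = A.charpoly.map Complex.ofRealHom :=
      Matrix.charpoly_map A Complex.ofRealHom
    have hB : (B.map (fun a : ℝ => (a : ℂ))).charpoly = B.charpoly.map Complex.ofRealHom :=
      Matrix.charpoly_map B Complex.ofRealHom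
    rw [hA, hB, h]
  simp only [perronValue, spectralRadius, hs]

lemma perronValue_reindex {m : Type*} [Fintype m] [DecidableEq m] (e : m ≃ n)
    (A : Matrix n n ℝ) : perronValue (A.submatrix e e) = perronValue A := by
  have hs : spectrum ℂ ((A.submatrix e e).map (fun a : ℝ => (a : ℂ)))
      = spectrum ℂ (A.map (fun a : ℝ => (a : ℂ))) := by
    ext μ
    rw [Matrix.mem_spectrum_iff_isRoot_charpoly, Matrix.mem_spectrum_iff_isRoot_charpoly]
    have h : (A.submatrix e e).map (fun a : ℝ => (a : ℂ))
        = Matrix.reindex e.symm e.symm (A.map (fun a : ℝ => (a : ℂ))) := rfl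
    rw [h, Matrix.charpoly_reindex]
  simp only [perronValue, spectralRadius, hs]

lemma spectralRadius_map_eq (hA : A.IsHermitian) :
    spectralRadius ℂ (A.map (fun a : ℝ => (a : ℂ))) = ⨆ i, (‖hA.eigenvalues i‖₊ : ENNReal) := by
  rw [spectralRadius, spectrum_map_eq hA, iSup_range]
  simp

lemma abs_eigenvalues_le_perronValue (hA : A.IsHermitian) (i : n) :
    |hA.eigenvalues i| ≤ perronValue A := by
  rw [perronValue, spectralRadius_map_eq hA]
  -- `toReal` sends `⊤` to `0`, so its monotonicity needs a finite supremum.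
  have hfin : (⨆ i, (‖hA.eigenvalues i‖₊ : ENNReal)) ≠ ⊤ := by
    have : Nonempty n := ⟨i⟩
    obtain ⟨j, hj⟩ := exists_eq_ciSup_of_finite (f := fun i => (‖hA.eigenvalues i‖₊ : ENNReal))
    rw [← hj]
    exact ENNReal.coe_ne_top
  have h := ENNReal.toReal_mono hfin
    (le_iSup (fun i => (‖hA.eigenvalues i‖₊ : ENNReal)) i)
  simpa using h

lemma exists_abs_eigenvalues_eq_perronValue [Nonempty n] (hA : A.IsHermitian) :
    ∃ i, |hA.eigenvalues i| = perronValue A := by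
  rw [perronValue, spectralRadius_map_eq hA]
  obtain ⟨j, hj⟩ := exists_eq_ciSup_of_finite (f := fun i => (‖hA.eigenvalues i‖₊ : ENNReal))
  refine ⟨j, ?_⟩
  rw [← hj]
  simp

lemma posSemidef_perronValue_sub (hA : A.IsHermitian) :
    (algebraMap ℝ (Matrix n n ℝ) (perronValue A) - A).PosSemidef := by
  have hH : (algebraMap ℝ (Matrix n n ℝ) (perronValue A) - A).IsHermitian := by
    refine Matrix.IsHermitian.sub ?_ hA
    rw [Matrix.algebraMap_eq_diagonal]
    exact Matrix.isHermitian_diagonal _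
  rw [hH.posSemidef_iff_eigenvalues_nonneg]
  intro i
  have hi := hH.eigenvalues_mem_spectrum_real i
  rw [← spectrum.singleton_sub_eq, hA.spectrum_real_eq_range_eigenvalues] at hi
  simp only [Set.singleton_sub, Set.mem_image, Set.mem_range, exists_exists_eq_and] at hi
  obtain ⟨j, hj⟩ := hi
  have := (le_abs_self _).trans (abs_eigenvalues_le_perronValue hA j)
  simp only [Pi.zero_apply]
  linarith

lemma sub_algebraMap_mulVec (c : ℝ) (A : Matrix n n ℝ) (y : n → ℝ) :
    (algebraMap ℝ (Matrix n n ℝ) c - A) *ᵥ y = c • y - A *ᵥ y := by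
  rw [Matrix.sub_mulVec, Algebra.algebraMap_eq_smul_one, Matrix.smul_mulVec, Matrix.one_mulVec]

lemma dotProduct_mulVec_le_perronValue (hA : A.IsHermitian) (y : n → ℝ) :
    y ⬝ᵥ (A *ᵥ y) ≤ perronValue A * (y ⬝ᵥ y) := by
  have h := (posSemidef_perronValue_sub hA).dotProduct_mulVec_nonneg y
  rw [sub_algebraMap_mulVec, star_trivial, dotProduct_sub, dotProduct_smul, smul_eq_mul] at h
  linarith

/-- A positive semidefinite form vanishes only on the kernel of its matrix, so equality in the
Rayleigh bound forces an eigenvector. -/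
lemma dotProduct_mulVec_lt_perronValue (hA : A.IsHermitian) {y : n → ℝ}
    (hy : A *ᵥ y ≠ perronValue A • y) :
    y ⬝ᵥ (A *ᵥ y) < perronValue A * (y ⬝ᵥ y) := by
  refine lt_of_le_of_ne (dotProduct_mulVec_le_perronValue hA y) fun heq => hy ?_
  have h := ((posSemidef_perronValue_sub hA).dotProduct_mulVec_zero_iff y).1 (by
    rw [sub_algebraMap_mulVec, star_trivial, dotProduct_sub, dotProduct_smul, smul_eq_mul, heq,
      sub_self])
  rw [sub_algebraMap_mulVec, sub_eq_zero] at h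
  exact h.symm

/-- The eigenvalue of largest modulus might be negative, hence the absolute value. -/
lemma exists_abs_dotProduct_eq_perronValue [Nonempty n] (hA : A.IsHermitian) :
    ∃ y : n → ℝ, 0 < y ⬝ᵥ y ∧ |y ⬝ᵥ (A *ᵥ y)| = perronValue A * (y ⬝ᵥ y) := by
  obtain ⟨i, hi⟩ := exists_abs_eigenvalues_eq_perronValue hA
  set y : n → ℝ := (hA.eigenvectorBasis i).ofLp with hy
  have hyne : y ≠ 0 := by
    intro h
    apply hA.eigenvectorBasis.orthonormal.ne_zero i
    ext j
    exact congrFun h j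
  have hpos : 0 < y ⬝ᵥ y := by
    have := Matrix.dotProduct_star_self_pos_iff (v := y)
    rw [star_trivial] at this
    exact this.2 hyne
  refine ⟨y, hpos, ?_⟩
  have : A *ᵥ y = hA.eigenvalues i • y := hA.mulVec_eigenvectorBasis i
  rw [this, dotProduct_smul, smul_eq_mul, abs_mul, hi, abs_of_pos hpos]

/-- For an extremal eigenvector `y` of `A`, the triangle inequality gives `|yᵀAy| ≤ |y|ᵀB|y|`, and
`|y|` has the norm of `y`. No positive eigenvector is needed. -/
lemma perronValue_mono [Nonempty n] (hA : A.IsHermitian) (hB : B.IsHermitian)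
    (h0 : ∀ i j, 0 ≤ A i j) (h : ∀ i j, A i j ≤ B i j) : perronValue A ≤ perronValue B := by
  obtain ⟨y, hpos, hy⟩ := exists_abs_dotProduct_eq_perronValue hA
  set z : n → ℝ := fun i => |y i| with hz
  have hzz : z ⬝ᵥ z = y ⬝ᵥ y := by simp [dotProduct, hz]
  have h1 : |y ⬝ᵥ (A *ᵥ y)| ≤ z ⬝ᵥ (B *ᵥ z) := by
    simp only [dotProduct, mulVec, Finset.mul_sum]
    refine (Finset.abs_sum_le_sum_abs _ _).trans (Finset.sum_le_sum fun i _ => ?_)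
    refine (Finset.abs_sum_le_sum_abs _ _).trans (Finset.sum_le_sum fun j _ => ?_)
    rw [abs_mul, abs_mul, abs_of_nonneg (h0 i j)]
    exact mul_le_mul_of_nonneg_left (mul_le_mul_of_nonneg_right (h i j) (abs_nonneg _))
      (abs_nonneg _)
  have h2 := h1.trans (dotProduct_mulVec_le_perronValue hB z)
  rw [hy, hzz] at h2
  exact le_of_mul_le_mul_right h2 hpos

lemma dotProduct_pow_two_mulVec (hA : A.IsSymm) (x : n → ℝ) :
    x ⬝ᵥ ((A ^ 2) *ᵥ x) = (A *ᵥ x) ⬝ᵥ (A *ᵥ x) := by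
  rw [pow_two, ← mulVec_mulVec, dotProduct_mulVec, ← mulVec_transpose, hA.eq]

lemma dotProduct_pow_three_mulVec (hA : A.IsSymm) (x : n → ℝ) :
    x ⬝ᵥ ((A ^ 3) *ᵥ x) = (A *ᵥ x) ⬝ᵥ (A *ᵥ (A *ᵥ x)) := by
  rw [pow_succ', pow_two, ← mulVec_mulVec, ← mulVec_mulVec, dotProduct_mulVec, ← mulVec_transpose,
    hA.eq]

/-- A strict lower bound for the Perron value of an invertible symmetric matrix. -/
lemma cSeq_three_lt_perronValue (hA : A.IsSymm) (hdet : IsUnit A.det) {x : n → ℝ}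
    (hx : ∀ c : ℝ, A *ᵥ x ≠ c • x) : cSeq 3 A x < perronValue A := by
  have hH : A.IsHermitian := by rw [Matrix.IsHermitian, conjTranspose_eq_transpose_of_trivial, hA.eq]
  have hinj : Function.Injective A.mulVec := Matrix.mulVec_injective_iff_isUnit.2
    ((Matrix.isUnit_iff_isUnit_det A).2 hdet)
  have hpos : 0 < (A *ᵥ x) ⬝ᵥ (A *ᵥ x) := by
    have := Matrix.dotProduct_star_self_pos_iff (v := A *ᵥ x)
    rw [star_trivial] at this
    refine this.2 fun h => ?_
    apply hx 0
    rw [h, zero_smul]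
  -- Equality would give `A(Ax) = ρ Ax`; cancelling `A` contradicts `hx`.
  have hlt : (A *ᵥ x) ⬝ᵥ (A *ᵥ (A *ᵥ x)) < perronValue A * ((A *ᵥ x) ⬝ᵥ (A *ᵥ x)) := by
    refine dotProduct_mulVec_lt_perronValue hH fun h => hx (perronValue A) (hinj ?_)
    rw [h, mulVec_smul]
  rw [cSeq, show 3 - 1 = 2 from rfl, dotProduct_pow_two_mulVec hA, dotProduct_pow_three_mulVec hA,
    div_lt_iff₀ hpos]
  exact hlt

end Perron

end RootedTreeBounds

namespace RootedTreeBounds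

open Matrix

/-! ### Parent maps and the factorization of the bottleneck matrix -/

section Rooted

/-- `p` sends every vertex of `G` other than the root `x` to its parent; every edge of `G` joins a
vertex to its parent. -/
structure IsParentMap {V : Type*} (G : SimpleGraph V) (x : V) (p : V → Option V) : Prop where
  adj_iff : ∀ u v, G.Adj u v ↔ p u = some v ∨ p v = some u
  eq_none_iff : ∀ u, p u = none ↔ u = x
  exists_height : ∃ h : V → ℕ, ∀ u v, p u = some v → h v < h u

variable {V : Type*} {G : SimpleGraph V} {x : V} {p : V → Option V}

lemma pathMatrix_eq_one {i j : V} (h : ∃ w : G.Walk j x, w.IsPath ∧ i ∈ w.support) :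
    pathMatrix G x i j = 1 := by
  simp only [pathMatrix, of_apply, if_pos h]

lemma pathMatrix_eq_zero {i j : V} (h : ¬ ∃ w : G.Walk j x, w.IsPath ∧ i ∈ w.support) :
    pathMatrix G x i j = 0 := by
  simp only [pathMatrix, of_apply, if_neg h]

lemma pathMatrix_nonneg (i j : V) : 0 ≤ pathMatrix G x i j := by
  simp only [pathMatrix, of_apply]
  split_ifs <;> norm_num

/-- Induction along the path. If its first step went from `a` to a child `b`, the rest would contain
the parent of `b`, which is `a`, and the path would repeat a vertex. So every step goes to the
parent and lowers the height. -/
lemma IsParentMap.path_support {h : V → ℕ} (hp : IsParentMap G x p)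
    (hh : ∀ u v, p u = some v → h v < h u) {a y : V} (w : G.Walk a y) (hy : y = x)
    (hw : w.IsPath) :
    (∀ i ∈ w.support, h i ≤ h a) ∧ ∀ b, p a = some b → b ∈ w.support := by
  induction w with
  | nil =>
    subst hy
    refine ⟨by simp, fun b hb => ?_⟩
    rw [(hp.eq_none_iff _).2 rfl] at hb
    cases hb
  | @cons a b y hab q ih =>
    have hq := hw.of_cons
    have ha : a ∉ q.support := ((SimpleGraph.Walk.cons_isPath_iff _ _).1 hw).2
    obtain ⟨ih1, ih2⟩ := ih hy hq
    rcases (hp.adj_iff a b).1 hab with h1 | h1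
    · refine ⟨fun i hi => ?_, fun c hc => ?_⟩
      · rw [SimpleGraph.Walk.support_cons, List.mem_cons] at hi
        rcases hi with rfl | hi
        · exact le_rfl
        · exact (ih1 i hi).trans (hh _ _ h1).le
      · rw [h1, Option.some.injEq] at hc
        subst hc
        simp
    · exact absurd (ih2 a h1) ha

lemma IsParentMap.exists_path (hp : IsParentMap G x p) (a : V) :
    ∃ w : G.Walk a x, w.IsPath := by
  classical
  obtain ⟨h, hh⟩ := hp.exists_height
  have key : ∀ n a, h a = n → Nonempty (G.Walk a x) := by
    intro n
    induction n using Nat.strong_induction_on with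
    | _ n ih =>
      intro a ha
      cases hpa : p a with
      | none =>
        rw [(hp.eq_none_iff a).1 hpa]
        exact ⟨SimpleGraph.Walk.nil⟩
      | some b =>
        obtain ⟨w⟩ := ih (h b) (ha ▸ hh a b hpa) b rfl
        exact ⟨SimpleGraph.Walk.cons ((hp.adj_iff a b).2 (Or.inl hpa)) w⟩
  obtain ⟨w⟩ := key _ a rfl
  exact ⟨w.bypass, w.bypass_isPath⟩

lemma IsParentMap.pathMatrix_root [DecidableEq V] (hp : IsParentMap G x p) (i : V) :
    pathMatrix G x i x = if i = x then 1 else 0 := by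
  simp only [pathMatrix, of_apply]
  congr 1
  simp only [eq_iff_iff]
  constructor
  · rintro ⟨w, hw, hi⟩
    simpa [SimpleGraph.Walk.nil_iff_support_eq.1 (SimpleGraph.Walk.isPath_iff_nil.1 hw)] using hi
  · rintro rfl
    exact ⟨SimpleGraph.Walk.nil, SimpleGraph.Walk.IsPath.nil, by simp⟩

lemma IsParentMap.pathMatrix_parent [DecidableEq V] (hp : IsParentMap G x p) (i : V) {j k : V}
    (hjk : p j = some k) :
    pathMatrix G x i j = (if i = j then 1 else 0) + pathMatrix G x i k := by
  obtain ⟨h, hh⟩ := hp.exists_height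
  have hnot : ∀ w : G.Walk k x, w.IsPath → j ∉ w.support := fun w hw hj =>
    absurd ((hp.path_support hh w rfl hw).1 j hj) (not_le.2 (hh j k hjk))
  have hadj : G.Adj j k := (hp.adj_iff j k).2 (Or.inl hjk)
  have key : (∃ w : G.Walk j x, w.IsPath ∧ i ∈ w.support) ↔
      i = j ∨ ∃ w : G.Walk k x, w.IsPath ∧ i ∈ w.support := by
    constructor
    · rintro ⟨w, hw, hi⟩
      cases w with
      | nil =>
        rw [(hp.eq_none_iff _).2 rfl] at hjk
        cases hjk
      | @cons _ c _ hjc q =>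
        have hj : j ∉ q.support := ((SimpleGraph.Walk.cons_isPath_iff _ _).1 hw).2
        -- A first step to a child `c` of `j` is impossible, since the rest of the path would return
        -- to `j`.
        have hck : c = k := by
          rcases (hp.adj_iff j c).1 hjc with h1 | h1
          · rw [h1] at hjk
            exact Option.some.inj hjk
          · exact absurd ((hp.path_support hh q rfl hw.of_cons).2 j h1) hj
        subst hck
        rw [SimpleGraph.Walk.support_cons, List.mem_cons] at hi
        exact hi.imp id fun hi => ⟨q, hw.of_cons, hi⟩
    · rintro (rfl | ⟨w, hw, hi⟩)
      · obtain ⟨w, hw⟩ := hp.exists_path i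
        exact ⟨w, hw, w.start_mem_support⟩
      · exact ⟨w.cons hadj, (SimpleGraph.Walk.cons_isPath_iff _ _).2 ⟨hw, hnot w hw⟩, by simp [hi]⟩
  by_cases hij : i = j
  · subst hij
    rw [pathMatrix_eq_one (key.2 (Or.inl rfl)), pathMatrix_eq_zero fun ⟨w, hw, hi⟩ => hnot w hw hi]
    simp
  · rw [if_neg hij, zero_add]
    by_cases hk : ∃ w : G.Walk k x, w.IsPath ∧ i ∈ w.support
    · rw [pathMatrix_eq_one hk, pathMatrix_eq_one (key.2 (Or.inr hk))]
    · rw [pathMatrix_eq_zero hk, pathMatrix_eq_zero fun h => (key.1 h).elim hij hk]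

/-- The recursion along parents determines the path matrix. -/
lemma IsParentMap.pathMatrix_eq [DecidableEq V] (hp : IsParentMap G x p) {N : Matrix V V ℝ}
    (hroot : ∀ i, N i x = if i = x then 1 else 0)
    (hrec : ∀ i j k, p j = some k → N i j = (if i = j then 1 else 0) + N i k) :
    pathMatrix G x = N := by
  obtain ⟨h, hh⟩ := hp.exists_height
  have key : ∀ n j, h j = n → ∀ i, pathMatrix G x i j = N i j := by
    intro n
    induction n using Nat.strong_induction_on with
    | _ n ih =>
      intro j hj i
      cases hpj : p j with
      | none =>
        rw [(hp.eq_none_iff j).1 hpj, hroot, hp.pathMatrix_root]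
      | some k =>
        rw [hrec i j k hpj, hp.pathMatrix_parent i hpj, ih (h k) (hj ▸ hh j k hpj) k rfl]
  ext i j
  exact key _ j rfl i

/-- The matrix with entry `1` at `(i, j)` if `i` is the parent of `j`. -/
def parentMatrix [DecidableEq V] (p : V → Option V) : Matrix V V ℝ :=
  of fun i j => if p j = some i then 1 else 0

/-- The parent of `u` is the second vertex on the unique path from `u` to `x`; the distance to `x`
is a height. -/
lemma exists_isParentMap_of_isTree (hG : G.IsTree) (x : V) : ∃ p, IsParentMap G x p := by
  classical
  choose w hw hlen using fun u => hG.1.exists_path_of_dist u x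
  have huniq : ∀ u (q : G.Walk u x), q.IsPath → q = w u := fun u q hq =>
    (hG.existsUnique_path u x).unique hq (hw u)
  have hnil : ∀ u, u ≠ x → ¬ (w u).Nil := fun u hu hn => hu hn.eq
  have hsnd : ∀ u v, G.Adj u v → v ∈ (w u).support → u ≠ x ∧ (w u).snd = v := by
    intro u v huv hv
    refine ⟨?_, (hG.2.eq_snd_of_adj_start (hw u) huv hv).symm⟩
    rintro rfl
    rw [SimpleGraph.Walk.nil_iff_support_eq.1 (SimpleGraph.Walk.isPath_iff_nil.1 (hw u)),
      List.mem_singleton] at hv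
    exact huv.ne hv.symm
  have hsome : ∀ u v, (if u = x then none else some (w u).snd) = some v ↔
      u ≠ x ∧ (w u).snd = v := by
    intro u v
    split_ifs with h <;> simp [h]
  refine ⟨fun u => if u = x then none else some (w u).snd, ?_, ?_, fun u => G.dist u x, ?_⟩
  · intro u v
    simp only [hsome]
    constructor
    · intro huv
      by_cases hv : v ∈ (w u).support
      · exact Or.inl (hsnd u v huv hv)
      · refine Or.inr (hsnd v u huv.symm ?_)
        rw [← huniq v ((w u).cons huv.symm)
          ((SimpleGraph.Walk.cons_isPath_iff _ _).2 ⟨hw u, hv⟩)]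
        simp
    · rintro (⟨hu, rfl⟩ | ⟨hv, rfl⟩)
      · exact (w u).adj_snd (hnil u hu)
      · exact ((w v).adj_snd (hnil v hv)).symm
  · intro u
    simp
  · intro u v huv
    obtain ⟨hu, rfl⟩ := (hsome u v).1 huv
    have h1 := SimpleGraph.dist_le (w u).tail
    have h2 := (w u).length_tail_add_one (hnil u hu)
    have h3 := hlen u
    show G.dist (w u).snd x < G.dist u x
    omega

lemma IsParentMap.ite_adj [DecidableEq V] (hp : IsParentMap G x p) [DecidableRel G.Adj] (i j : V) :
    (if G.Adj i j then (1 : ℝ) else 0) = parentMatrix p i j + parentMatrix p j i := by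
  obtain ⟨h, hh⟩ := hp.exists_height
  simp only [parentMatrix, of_apply]
  by_cases h1 : p i = some j
  · have h2 : p j ≠ some i := fun h2 => (hh _ _ h1).asymm (hh _ _ h2)
    simp [hp.adj_iff, h1, h2]
  · simp [hp.adj_iff, h1]

variable [Fintype V] [DecidableEq V]

lemma IsParentMap.pathMatrix_mul (hp : IsParentMap G x p) :
    pathMatrix G x * (1 - parentMatrix p) = 1 := by
  ext i j
  rw [mul_sub, mul_one, Matrix.sub_apply, Matrix.mul_apply, one_apply]
  cases hpj : p j with
  | none =>
    have hj := (hp.eq_none_iff j).1 hpj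
    subst hj
    simp [parentMatrix, hpj, hp.pathMatrix_root]
  | some k =>
    simp [parentMatrix, hpj, hp.pathMatrix_parent i hpj]

/-- Distinct vertices have no common child, so the product is diagonal and counts children. -/
lemma parentMatrix_mul_transpose_apply (p : V → Option V) (i j : V) :
    (parentMatrix p * (parentMatrix p)ᵀ) i j
      = if i = j then ∑ k, parentMatrix p i k else 0 := by
  rw [Matrix.mul_apply]
  split_ifs with hij
  · subst hij
    refine Finset.sum_congr rfl fun k _ => ?_
    simp [parentMatrix]
  · refine Finset.sum_eq_zero fun k _ => ?_
    simp only [parentMatrix, of_apply, transpose_apply]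
    by_cases h1 : p k = some i
    · simp [h1, hij]
    · simp [h1]

lemma degree_eq_sum_ite {W : Type*} [Fintype W] (H : SimpleGraph W) [DecidableRel H.Adj] (v : W) :
    (H.degree v : ℝ) = ∑ w, if H.Adj v w then (1 : ℝ) else 0 := by
  rw [← SimpleGraph.card_neighborFinset_eq_degree, SimpleGraph.neighborFinset_eq_filter,
    Finset.sum_boole]

-- The added vertex acts as a parent of the root, so every vertex has degree one plus its number of
-- children. These degrees are the diagonal of `1 + PPᵀ`, and the edges contribute `-P - Pᵀ`.
open Classical in
lemma IsParentMap.reducedLaplacian (hp : IsParentMap G x p) (i j : V) :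
    (addPendent G x).lapMatrix ℝ (some i) (some j)
      = ((1 - parentMatrix p) * (1 - parentMatrix p)ᵀ : Matrix V V ℝ) i j := by
  have hadj : ∀ a b, (addPendent G x).Adj (some a) (some b) ↔ G.Adj a b := fun a b => Iff.rfl
  have hnone : ∀ a, (addPendent G x).Adj (some a) none ↔ a = x := fun a => Iff.rfl
  have hsum : (if i = x then (1 : ℝ) else 0) + ∑ k, parentMatrix p k i = 1 := by
    cases hpi : p i with
    | none =>
      rw [if_pos ((hp.eq_none_iff i).1 hpi)]
      simp [parentMatrix, hpi]
    | some k =>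
      have : i ≠ x := fun h => by
        rw [(hp.eq_none_iff i).2 h] at hpi
        cases hpi
      simp [parentMatrix, hpi, this]
  have hdeg : ((addPendent G x).degree (some i) : ℝ) = 1 + ∑ k, parentMatrix p i k := by
    rw [degree_eq_sum_ite, Fintype.sum_option]
    simp only [hadj, hnone, hp.ite_adj, Finset.sum_add_distrib]
    linarith
  have hexp : ((1 - parentMatrix p) * (1 - parentMatrix p)ᵀ : Matrix V V ℝ)
      = 1 - parentMatrix p - (parentMatrix p)ᵀ + parentMatrix p * (parentMatrix p)ᵀ := by
    rw [transpose_sub, transpose_one]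
    noncomm_ring
  rw [hexp]
  simp only [Matrix.add_apply, Matrix.sub_apply, parentMatrix_mul_transpose_apply,
    SimpleGraph.lapMatrix, SimpleGraph.degMatrix, SimpleGraph.adjMatrix_apply, hadj, hp.ite_adj,
    transpose_apply, one_apply, diagonal_apply, Option.some.injEq, hdeg]
  split_ifs <;> ring

/-- The bottleneck matrix of a rooted tree with path matrix `N` is `Nᵀ N`. -/
lemma IsParentMap.bottleneckMatrix_eq (hp : IsParentMap G x p) :
    bottleneckMatrix G x = (pathMatrix G x)ᵀ * pathMatrix G x := by
  classical
  let e : V ≃ {w : Option V // w ≠ none} :=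
    Equiv.ofBijective (fun a => ⟨some a, Option.some_ne_none a⟩)
      ⟨fun a b h => by simpa using h, fun ⟨w, hw⟩ => by
        obtain ⟨a, rfl⟩ := Option.ne_none_iff_exists'.1 hw
        exact ⟨a, rfl⟩⟩
  have h1 : bottleneckMatrix G x = (bottleneckAt (addPendent G x) none).submatrix e e := rfl
  have hND := hp.pathMatrix_mul
  have hDN := mul_eq_one_comm.1 hND
  rw [h1, bottleneckAt, ← inv_submatrix_equiv]
  refine Matrix.inv_eq_right_inv ?_
  rw [submatrix_submatrix]
  have h2 : ((addPendent G x).lapMatrix ℝ).submatrix (Subtype.val ∘ e) (Subtype.val ∘ e)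
      = ((1 - parentMatrix p) * (1 - parentMatrix p)ᵀ : Matrix V V ℝ) := by
    ext i j
    rw [← hp.reducedLaplacian]
    rfl
  -- Here `(1 - P)(1 - P)ᵀNᵀN = (1 - P)(N(1 - P))ᵀN = (1 - P)N = 1`.
  rw [h2, Matrix.mul_assoc, ← Matrix.mul_assoc _ᵀ, ← transpose_mul, hND, transpose_one,
    Matrix.one_mul, hDN]

lemma IsParentMap.isUnit_det_pathMatrix (hp : IsParentMap G x p) :
    IsUnit (pathMatrix G x).det :=
  Matrix.isUnit_det_of_right_inverse hp.pathMatrix_mul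

end Rooted

end RootedTreeBounds

namespace RootedTreeBounds

open Matrix

/-! ### The broom: explicit quotients and extremality -/

section Broom

/-- The parent map of the rooted broom `B₁(d, r)`. -/
def broomParent (d r : ℕ) (hd : 0 < d) : Fin d ⊕ Fin r → Option (Fin d ⊕ Fin r)
  | Sum.inl i => if i.val = 0 then none else some (Sum.inl ⟨i.val - 1, by omega⟩)
  | Sum.inr _ => some (broomRoot d r hd)

lemma broom_isParentMap (d r : ℕ) (hd : 0 < d) :
    IsParentMap (broom d r) (broomRoot d r hd) (broomParent d r hd) where
  adj_iff u v := by
    rcases u with i | k <;> rcases v with j | l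
    · simp only [broom, SimpleGraph.fromRel_adj, broomParent, ne_eq, Sum.inl.injEq, Fin.ext_iff]
      split_ifs <;> simp [Fin.ext_iff] <;> omega
    · simp only [broom, SimpleGraph.fromRel_adj, broomParent, broomRoot]
      split_ifs <;> simp [Fin.ext_iff] <;> omega
    · simp only [broom, SimpleGraph.fromRel_adj, broomParent, broomRoot]
      split_ifs <;> simp [Fin.ext_iff] <;> omega
    · simp [broom, broomParent, broomRoot]
  eq_none_iff u := by
    rcases u with i | k
    · simp [broomParent, broomRoot, Fin.ext_iff]
    · simp [broomParent, broomRoot]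
  exists_height := by
    refine ⟨Sum.elim (fun i => i.val) (fun _ => 1), ?_⟩
    rintro (i | k) v huv
    · simp only [broomParent] at huv
      split_ifs at huv with hi
      obtain rfl := Option.some.inj huv
      simp
      omega
    · obtain rfl := Option.some.inj huv
      simp [broomRoot]

/-- The path matrix of the rooted broom `B₁(d, r)`, entry by entry. -/
def broomN (d r : ℕ) : Matrix (Fin d ⊕ Fin r) (Fin d ⊕ Fin r) ℝ :=
  of fun
    | Sum.inl i, Sum.inl j => if i.val ≤ j.val then 1 else 0
    | Sum.inl i, Sum.inr _ => if i.val = 0 then 1 else 0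
    | Sum.inr _, Sum.inl _ => 0
    | Sum.inr k, Sum.inr l => if k = l then 1 else 0

lemma pathMatrix_broom (d r : ℕ) (hd : 0 < d) :
    pathMatrix (broom d r) (broomRoot d r hd) = broomN d r := by
  refine (broom_isParentMap d r hd).pathMatrix_eq ?_ ?_
  · rintro (i | k)
    · simp only [broomN, broomRoot, of_apply, Sum.inl.injEq, Fin.ext_iff, Nat.le_zero]
    · simp [broomN, broomRoot]
  · intro i j k hjk
    rcases j with j | l
    · simp only [broomParent] at hjk
      split_ifs at hjk with hj
      obtain rfl := Option.some.inj hjk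
      rcases i with i | m
      · simp only [broomN, of_apply, Sum.inl.injEq, Fin.ext_iff]
        rcases lt_trichotomy i.val j.val with h | h | h
        · rw [if_pos h.le, if_neg h.ne, if_pos (by omega)]; ring
        · rw [if_pos h.le, if_pos h, if_neg (by omega)]; ring
        · rw [if_neg (by omega), if_neg h.ne', if_neg (by omega)]; ring
      · simp [broomN]
    · obtain rfl := Option.some.inj hjk
      rcases i with i | m
      · simp only [broomN, broomRoot, of_apply, Nat.le_zero, reduceCtorEq, if_false, zero_add]
      · simp [broomN, broomRoot]

lemma broomM_eq (d r : ℕ) (hd : 0 < d) : broomM d r hd = (broomN d r)ᵀ * broomN d r := by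
  rw [broomM, (broom_isParentMap d r hd).bottleneckMatrix_eq, pathMatrix_broom]

lemma broomQ_eq (d r : ℕ) (hd : 0 < d) : broomQ d r hd = broomN d r * (broomN d r)ᵀ := by
  rw [broomQ, neckbottleMatrix, pathMatrix_broom]

lemma perronValue_broomM_eq_broomQ (d r : ℕ) (hd : 0 < d) :
    perronValue (broomM d r hd) = perronValue (broomQ d r hd) := by
  rw [broomM_eq, broomQ_eq]
  exact perronValue_eq_of_charpoly_eq (Matrix.charpoly_mul_comm _ _)

lemma broomM_isSymm (d r : ℕ) (hd : 0 < d) : (broomM d r hd).IsSymm := by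
  rw [broomM_eq, Matrix.IsSymm, transpose_mul, transpose_transpose]

lemma broomQ_isSymm (d r : ℕ) (hd : 0 < d) : (broomQ d r hd).IsSymm := by
  rw [broomQ_eq, Matrix.IsSymm, transpose_mul, transpose_transpose]

lemma isUnit_det_broomN (d r : ℕ) (hd : 0 < d) : IsUnit (broomN d r).det := by
  rw [← pathMatrix_broom d r hd]
  exact (broom_isParentMap d r hd).isUnit_det_pathMatrix

lemma isUnit_det_broomM (d r : ℕ) (hd : 0 < d) : IsUnit (broomM d r hd).det := by
  rw [broomM_eq, det_mul, det_transpose]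
  exact (isUnit_det_broomN d r hd).mul (isUnit_det_broomN d r hd)

lemma isUnit_det_broomQ (d r : ℕ) (hd : 0 < d) : IsUnit (broomQ d r hd).det := by
  rw [broomQ_eq, det_mul, det_transpose]
  exact (isUnit_det_broomN d r hd).mul (isUnit_det_broomN d r hd)

/-- Telescoping with a discrete antiderivative `F` of `f`. On the path, `broomN` takes tail sums and
its transpose takes initial sums, so polynomial vectors stay polynomial there, up to an extra term
at the root. -/
lemma sum_fin_ge {f F : ℕ → ℝ} (hF : ∀ n, F (n + 1) = F n + f n) {d i : ℕ} (hi : i ≤ d) :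
    ∑ j : Fin d, (if i ≤ j.val then f j else 0) = F d - F i := by
  rw [Fin.sum_univ_eq_sum_range (fun j => if i ≤ j then f j else 0) d]
  induction d, hi using Nat.le_induction with
  | base =>
    rw [sub_self]
    exact Finset.sum_eq_zero fun j hj => if_neg (not_le.2 (Finset.mem_range.1 hj))
  | succ m hm ih =>
    rw [Finset.sum_range_succ, ih, if_pos hm, hF]
    ring

lemma sum_fin_le {f F : ℕ → ℝ} (hF : ∀ n, F (n + 1) = F n + f n) {d : ℕ} (i : Fin d) :
    ∑ j : Fin d, (if j.val ≤ i.val then f j else 0) = F (i + 1) - F 0 := by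
  have h0 := sum_fin_ge hF (Nat.zero_le d)
  have h1 := sum_fin_ge hF (Nat.succ_le_of_lt i.isLt)
  have h : ∀ j : Fin d, (if j.val ≤ i.val then f j else 0)
      = (if 0 ≤ j.val then f j else 0) - (if i.val + 1 ≤ j.val then f j else 0) := by
    intro j
    rcases le_or_gt j.val i.val with h | h
    · rw [if_pos h, if_pos (Nat.zero_le _), if_neg (by omega), sub_zero]
    · rw [if_neg (by omega), if_pos (Nat.zero_le _), if_pos (by omega), sub_self]
  rw [Finset.sum_congr rfl fun j _ => h j, Finset.sum_sub_distrib, h0]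
  erw [h1]
  ring

lemma sum_fin_ite_eq_zero {d : ℕ} (hd : 0 < d) (f : ℕ → ℝ) :
    ∑ i : Fin d, (if i.val = 0 then f i else 0) = f 0 := by
  rw [Finset.sum_eq_single ⟨0, hd⟩]
  · simp
  · intro i _ hi
    exact if_neg fun h => hi (Fin.ext h)
  · simp

lemma broomN_mulVec {d r : ℕ} {f F : ℕ → ℝ} (hF : ∀ n, F (n + 1) = F n + f n) (t : ℝ) :
    broomN d r *ᵥ Sum.elim (fun j : Fin d => f j) (fun _ => t)
      = Sum.elim (fun i : Fin d => F d - F i + if i.val = 0 then r * t else 0) (fun _ => t) := by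
  ext (i | k)
  · simp only [mulVec, dotProduct, Fintype.sum_sum_type, broomN, of_apply, Sum.elim_inl,
      Sum.elim_inr, ite_mul, one_mul, zero_mul, sum_fin_ge hF i.isLt.le]
    split_ifs <;> simp
  · simp [mulVec, dotProduct, Fintype.sum_sum_type, broomN]

lemma broomN_transpose_mulVec {d r : ℕ} (hd : 0 < d) {f F : ℕ → ℝ}
    (hF : ∀ n, F (n + 1) = F n + f n) (s t : ℝ) :
    (broomN d r)ᵀ *ᵥ
        Sum.elim (fun i : Fin d => f i + if i.val = 0 then s else 0) (fun _ => t)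
      = Sum.elim (fun j : Fin d => F (j + 1) - F 0 + s) (fun _ => f 0 + s + t) := by
  ext (j | k)
  · simp only [mulVec, dotProduct, Fintype.sum_sum_type, broomN, transpose_apply, of_apply,
      Sum.elim_inl, Sum.elim_inr, zero_mul, Finset.sum_const_zero, add_zero, mul_add,
      Finset.sum_add_distrib, ite_mul, one_mul, sum_fin_le hF j]
    congr 1
    rw [Finset.sum_congr rfl fun i _ => (by split_ifs <;> first | rfl | omega :
      (if i.val ≤ j.val then (if i.val = 0 then s else 0) else 0) = if i.val = 0 then s else 0)]
    exact sum_fin_ite_eq_zero hd fun _ => s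
  · simp only [mulVec, dotProduct, Fintype.sum_sum_type, broomN, transpose_apply, of_apply,
      Sum.elim_inl, Sum.elim_inr, mul_add, Finset.sum_add_distrib, ite_mul, one_mul, zero_mul,
      sum_fin_ite_eq_zero hd f, Finset.sum_ite_eq', Finset.mem_univ, if_true]
    congr 2
    rw [Finset.sum_congr rfl fun i _ => (by split_ifs <;> rfl :
      (if i.val = 0 then (if i.val = 0 then s else 0) else 0) = if i.val = 0 then s else 0)]
    exact sum_fin_ite_eq_zero hd fun _ => s

/-- The seven terms are the power sums of exponents `0` to `6`. Degree three suffices for every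
vector whose norm is needed below. -/
lemma sum_range_sq_cubic (g₀ g₁ g₂ g₃ : ℝ) (n : ℕ) :
    ∑ i ∈ Finset.range n, (g₀ + g₁ * i + g₂ * i ^ 2 + g₃ * i ^ 3) ^ 2
      = g₀ ^ 2 * n + 2 * g₀ * g₁ * (n * (n - 1) / 2)
        + (g₁ ^ 2 + 2 * g₀ * g₂) * (n * (n - 1) * (2 * n - 1) / 6)
        + 2 * (g₀ * g₃ + g₁ * g₂) * (n ^ 2 * (n - 1) ^ 2 / 4)
        + (g₂ ^ 2 + 2 * g₁ * g₃) * (n * (n - 1) * (2 * n - 1) * (3 * n ^ 2 - 3 * n - 1) / 30)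
        + 2 * g₂ * g₃ * (n ^ 2 * (n - 1) ^ 2 * (2 * n ^ 2 - 2 * n - 1) / 12)
        + g₃ ^ 2 * (n * (n - 1) * (2 * n - 1) * (3 * n ^ 4 - 6 * n ^ 3 + 3 * n + 1) / 42) := by
  induction n with
  | zero => simp
  | succ m ih =>
    rw [Finset.sum_range_succ, ih]
    push_cast
    ring

lemma dotProduct_self_elim {d r : ℕ} (hd : 0 < d) (g : ℕ → ℝ) (s t : ℝ) :
    Sum.elim (fun i : Fin d => g i + if i.val = 0 then s else 0) (fun _ : Fin r => t)
        ⬝ᵥ Sum.elim (fun i : Fin d => g i + if i.val = 0 then s else 0) (fun _ : Fin r => t)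
      = (∑ i ∈ Finset.range d, g i ^ 2) + 2 * s * g 0 + s ^ 2 + r * t ^ 2 := by
  have h : ∀ i : Fin d, (g i + if i.val = 0 then s else 0) * (g i + if i.val = 0 then s else 0)
      = g i ^ 2 + if i.val = 0 then 2 * s * g i + s ^ 2 else 0 := by
    intro i
    split_ifs <;> ring
  simp only [dotProduct, Fintype.sum_sum_type, Sum.elim_inl, Sum.elim_inr, h,
    Finset.sum_add_distrib]
  rw [sum_fin_ite_eq_zero hd fun i => 2 * s * g i + s ^ 2,
    Fin.sum_univ_eq_sum_range (fun i => g i ^ 2) d]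
  simp
  ring

lemma one_eq_elim (d r : ℕ) :
    (1 : Fin d ⊕ Fin r → ℝ) = Sum.elim (fun _ => 1) (fun _ => 1) := by
  ext (i | k) <;> rfl

lemma broomN_mulVec_one (d r : ℕ) :
    broomN d r *ᵥ 1
      = Sum.elim (fun i : Fin d => ((d : ℝ) - i) + if i.val = 0 then (r : ℝ) else 0)
        (fun _ => 1) := by
  rw [one_eq_elim, broomN_mulVec (f := fun _ => 1) (F := fun n => (n : ℝ)) (fun n => by simp) 1,
    mul_one]

lemma broomN_transpose_mulVec_one {d : ℕ} (r : ℕ) (hd : 0 < d) :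
    (broomN d r)ᵀ *ᵥ 1 = Sum.elim (fun j : Fin d => (j : ℝ) + 1) (fun _ => 2) := by
  have h := broomN_transpose_mulVec (r := r) hd (f := fun _ => 1) (F := fun n => (n : ℝ))
    (fun n => by simp) 0 1
  simp only [ite_self, add_zero] at h
  rw [one_eq_elim, h]
  ext (j | k)
  · simp
  · simp; norm_num

lemma broomM_mulVec_one {d : ℕ} (r : ℕ) (hd : 0 < d) :
    broomM d r hd *ᵥ 1
      = Sum.elim (fun j : Fin d => ((d : ℝ) + r) + (d - 1 / 2) * j + (-1 / 2) * (j : ℝ) ^ 2)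
        (fun _ => (d : ℝ) + r + 1) := by
  rw [broomM_eq, ← mulVec_mulVec, broomN_mulVec_one,
    broomN_transpose_mulVec hd (f := fun n => (d : ℝ) - n)
      (F := fun n => d * (n : ℝ) - n * (n - 1) / 2) (fun n => by push_cast; ring)]
  ext (j | k)
  · simp only [Sum.elim_inl]; push_cast; ring
  · simp

lemma broomQ_mulVec_one {d : ℕ} (r : ℕ) (hd : 0 < d) :
    broomQ d r hd *ᵥ 1
      = Sum.elim (fun i : Fin d => ((d : ℝ) * (d + 1) / 2 + (-1 / 2) * i + (-1 / 2) * (i : ℝ) ^ 2)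
          + if i.val = 0 then (r : ℝ) * 2 else 0) (fun _ => 2) := by
  rw [broomQ_eq, ← mulVec_mulVec, broomN_transpose_mulVec_one r hd,
    broomN_mulVec (f := fun n => (n : ℝ) + 1) (F := fun n => (n : ℝ) * (n + 1) / 2)
      (fun n => by push_cast; ring)]
  ext (j | k)
  · simp only [Sum.elim_inl]; ring
  · simp

lemma broomN_mulVec_broomM_mulVec_one {d : ℕ} (r : ℕ) (hd : 0 < d) :
    broomN d r *ᵥ (broomM d r hd *ᵥ 1)
      = Sum.elim (fun i : Fin d => ((((d : ℝ) + r) * d + (d - 1 / 2) * (d * (d - 1) / 2)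
          + (-1 / 2) * (d * (d - 1) * (2 * d - 1) / 6))
          + (-(d + r) + (d - 1 / 2) / 2 + 1 / 12) * i
          + (-(d - 1 / 2) / 2 - 1 / 4) * (i : ℝ) ^ 2 + 1 / 6 * (i : ℝ) ^ 3)
          + if i.val = 0 then (r : ℝ) * (d + r + 1) else 0) (fun _ => (d : ℝ) + r + 1) := by
  rw [broomM_mulVec_one r hd, broomN_mulVec
    (f := fun j => ((d : ℝ) + r) + (d - 1 / 2) * j + (-1 / 2) * (j : ℝ) ^ 2)
    (F := fun n => ((d : ℝ) + r) * n + (d - 1 / 2) * (n * (n - 1) / 2)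
      + (-1 / 2) * (n * (n - 1) * (2 * n - 1) / 6)) (fun n => by push_cast; ring)]
  ext (j | k)
  · simp only [Sum.elim_inl]; ring
  · simp

lemma broomN_transpose_mulVec_broomQ_mulVec_one {d : ℕ} (r : ℕ) (hd : 0 < d) :
    (broomN d r)ᵀ *ᵥ (broomQ d r hd *ᵥ 1)
      = Sum.elim (fun j : Fin d => ((d : ℝ) * (d + 1) / 2 + r * 2)
          + (d * (d + 1) / 2 - 1 / 3) * j + (-1 / 2) * (j : ℝ) ^ 2 + (-1 / 6) * (j : ℝ) ^ 3)
        (fun _ => (d : ℝ) * (d + 1) / 2 + r * 2 + 2) := by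
  rw [broomQ_mulVec_one r hd, broomN_transpose_mulVec hd
    (f := fun i => (d : ℝ) * (d + 1) / 2 + (-1 / 2) * i + (-1 / 2) * (i : ℝ) ^ 2)
    (F := fun n => (d : ℝ) * (d + 1) / 2 * n + (-1 / 2) * (n * (n - 1) / 2)
      + (-1 / 2) * (n * (n - 1) * (2 * n - 1) / 6)) (fun n => by push_cast; ring)]
  ext (j | k)
  · simp only [Sum.elim_inl]; push_cast; ring
  · simp

/-- With `y = A1` this writes `1ᵀA³1` as the squared norm of `BA1`, avoiding a further
multiplication by `Bᵀ`. -/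
lemma dotProduct_mulVec_of_eq_transpose_mul {n : Type*} [Fintype n] {A B : Matrix n n ℝ}
    (h : A = Bᵀ * B) (y : n → ℝ) : y ⬝ᵥ (A *ᵥ y) = (B *ᵥ y) ⬝ᵥ (B *ᵥ y) := by
  rw [h, ← mulVec_mulVec, dotProduct_mulVec, ← mulVec_transpose, transpose_transpose]

lemma broomM_two {d : ℕ} (r : ℕ) (hd : 0 < d) :
    (1 : Fin d ⊕ Fin r → ℝ) ⬝ᵥ ((broomM d r hd ^ 2) *ᵥ 1) = V₂ d r := by
  have h := dotProduct_self_elim (r := r) hd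
    (fun j => ((d : ℝ) + r) + (d - 1 / 2) * j + (-1 / 2) * (j : ℝ) ^ 2 + 0 * (j : ℝ) ^ 3) 0
    ((d : ℝ) + r + 1)
  rw [sum_range_sq_cubic] at h
  simp only [ite_self, add_zero, zero_mul] at h
  rw [dotProduct_pow_two_mulVec (broomM_isSymm d r hd), broomM_mulVec_one r hd, h, V₂]
  push_cast
  ring

lemma broomM_three {d : ℕ} (r : ℕ) (hd : 0 < d) :
    (1 : Fin d ⊕ Fin r → ℝ) ⬝ᵥ ((broomM d r hd ^ 3) *ᵥ 1) = V₁ d r := by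
  rw [dotProduct_pow_three_mulVec (broomM_isSymm d r hd),
    dotProduct_mulVec_of_eq_transpose_mul (broomM_eq d r hd),
    broomN_mulVec_broomM_mulVec_one,
    dotProduct_self_elim hd
    (fun i => (((d : ℝ) + r) * d + (d - 1 / 2) * (d * (d - 1) / 2)
          + (-1 / 2) * (d * (d - 1) * (2 * d - 1) / 6))
          + (-(d + r) + (d - 1 / 2) / 2 + 1 / 12) * i
          + (-(d - 1 / 2) / 2 - 1 / 4) * (i : ℝ) ^ 2 + 1 / 6 * (i : ℝ) ^ 3),
    sum_range_sq_cubic, V₁]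
  push_cast
  ring

lemma broomQ_two {d : ℕ} (r : ℕ) (hd : 0 < d) :
    (1 : Fin d ⊕ Fin r → ℝ) ⬝ᵥ ((broomQ d r hd ^ 2) *ᵥ 1) = U₂ d r := by
  have h := dotProduct_self_elim (r := r) hd
    (fun i => (d : ℝ) * (d + 1) / 2 + (-1 / 2) * i + (-1 / 2) * (i : ℝ) ^ 2 + 0 * (i : ℝ) ^ 3)
    ((r : ℝ) * 2) 2
  rw [sum_range_sq_cubic] at h
  simp only [add_zero, zero_mul] at h
  rw [dotProduct_pow_two_mulVec (broomQ_isSymm d r hd), broomQ_mulVec_one r hd, h, U₂]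
  push_cast
  ring

lemma broomQ_three {d : ℕ} (r : ℕ) (hd : 0 < d) :
    (1 : Fin d ⊕ Fin r → ℝ) ⬝ᵥ ((broomQ d r hd ^ 3) *ᵥ 1) = U₁ d r := by
  have h := dotProduct_self_elim (r := r) hd
    (fun j => ((d : ℝ) * (d + 1) / 2 + r * 2)
          + (d * (d + 1) / 2 - 1 / 3) * j + (-1 / 2) * (j : ℝ) ^ 2 + (-1 / 6) * (j : ℝ) ^ 3)
    0 ((d : ℝ) * (d + 1) / 2 + r * 2 + 2)
  rw [sum_range_sq_cubic] at h
  simp only [ite_self, add_zero] at h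
  have hQ : broomQ d r hd = (broomN d r)ᵀᵀ * (broomN d r)ᵀ := by
    rw [transpose_transpose, broomQ_eq]
  rw [dotProduct_pow_three_mulVec (broomQ_isSymm d r hd),
    dotProduct_mulVec_of_eq_transpose_mul hQ,
    broomN_transpose_mulVec_broomQ_mulVec_one, h, U₁]
  push_cast
  ring

lemma cSeq_broomM {d : ℕ} (r : ℕ) (hd : 0 < d) : cSeq 3 (broomM d r hd) 1 = V₁ d r / V₂ d r := by
  rw [cSeq, broomM_three, show 3 - 1 = 2 from rfl, broomM_two]

lemma cSeq_broomQ {d : ℕ} (r : ℕ) (hd : 0 < d) : cSeq 3 (broomQ d r hd) 1 = U₁ d r / U₂ d r := by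
  rw [cSeq, broomQ_three, show 3 - 1 = 2 from rfl, broomQ_two]

/-- `M₁1` has entry `d + r` at the root and `d + r + 1` at a pendent vertex, so it is not a multiple
of `1`. -/
lemma cSeq_broomM_lt {d r : ℕ} (hd : 0 < d) (hr : 0 < r) :
    cSeq 3 (broomM d r hd) 1 < perronValue (broomM d r hd) := by
  refine cSeq_three_lt_perronValue (broomM_isSymm d r hd) (isUnit_det_broomM d r hd) fun c h => ?_
  rw [broomM_mulVec_one] at h
  have h1 := congrFun h (Sum.inl ⟨0, hd⟩)
  have h2 := congrFun h (Sum.inr ⟨0, hr⟩)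
  simp at h1 h2
  linarith

/-- `Q₁1` has entry `d(d + 1)/2 + 2r ≥ 3` at the root and `2` at a pendent vertex. -/
lemma cSeq_broomQ_lt {d r : ℕ} (hd : 0 < d) (hr : 0 < r) :
    cSeq 3 (broomQ d r hd) 1 < perronValue (broomQ d r hd) := by
  refine cSeq_three_lt_perronValue (broomQ_isSymm d r hd) (isUnit_det_broomQ d r hd) fun c h => ?_
  rw [broomQ_mulVec_one] at h
  have h1 := congrFun h (Sum.inl ⟨0, hd⟩)
  have h2 := congrFun h (Sum.inr ⟨0, hr⟩)
  simp at h1 h2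
  have hd' : (1 : ℝ) ≤ d := by exact_mod_cast hd
  have hr' : (1 : ℝ) ≤ r := by exact_mod_cast hr
  nlinarith

/-- A family of distinct vertices, indexed by `Fin d`, extends to an enumeration. -/
lemma exists_equiv_extending {V : Type*} [Fintype V] {d r : ℕ} {c : Fin d → V}
    (hc : Function.Injective c) (hcard : Fintype.card V = d + r) :
    ∃ e : Fin d ⊕ Fin r ≃ V, ∀ i, e (Sum.inl i) = c i := by
  classical
  let e₁ : Fin d ≃ Set.range c := Equiv.ofInjective c hc
  have hcompl : Fintype.card ((Set.range c)ᶜ : Set V) = Fintype.card (Fin r) := by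
    rw [Fintype.card_compl_set, ← Fintype.card_congr e₁, hcard, Fintype.card_fin, Fintype.card_fin,
      Nat.add_sub_cancel_left]
  let e₂ : Fin r ≃ ((Set.range c)ᶜ : Set V) := (Fintype.equivOfCardEq hcompl).symm
  exact ⟨(Equiv.sumCongr e₁ e₂).trans (Equiv.Set.sumCompl (Set.range c)), fun i => rfl⟩

/-- Among the rooted trees with a path from the root on `d` vertices and with `r` further vertices,
the broom has the smallest Perron value. -/
lemma perronValue_broomM_le {V : Type*} [Fintype V] [DecidableEq V] {T : SimpleGraph V} {x y : V}
    (hT : T.IsTree) {d r : ℕ} (hd : 0 < d) (w : T.Walk y x) (hw : w.IsPath) (hlen : d ≤ w.length)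
    (hcard : Fintype.card V = d + r) :
    perronValue (broomM d r hd) ≤ perronValue (bottleneckMatrix T x) := by
  obtain ⟨p, hp⟩ := exists_isParentMap_of_isTree hT x
  -- `w` runs towards the root, so `c i` is the vertex of `w` that is `i` steps from `x`. Only the
  -- `d` vertices nearest the root are used; the far end of `w` counts among the other `r`.
  let c : Fin d → V := fun i => w.getVert (w.length - i)
  have hc : Function.Injective c := by
    intro i j hij
    have h := hw.getVert_injOn (show w.length - i ≤ w.length by omega)
      (show w.length - j ≤ w.length by omega) hij
    apply Fin.ext
    have := i.isLt
    have := j.isLt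
    omega
  obtain ⟨e, he⟩ := exists_equiv_extending hc hcard
  -- For a vertex off the chain, the broom's column marks only the root and the vertex itself, and
  -- both lie on its path in any tree.
  have hle : ∀ k a, broomN d r k a ≤ pathMatrix T x (e k) (e a) := by
    rintro (i | k) (j | l)
    · simp only [broomN, of_apply]
      split_ifs with hij
      · refine (pathMatrix_eq_one ?_).ge
        rw [he, he]
        refine ⟨w.drop (w.length - j), hw.drop _, ?_⟩
        have h := (w.drop (w.length - j)).getVert_mem_support (j - i)
        rw [SimpleGraph.Walk.drop_getVert] at h
        have hj := j.isLt
        rwa [show w.length - j + (j - i) = w.length - i by omega] at h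
      · exact pathMatrix_nonneg _ _
    · simp only [broomN, of_apply]
      split_ifs with hi
      · refine (pathMatrix_eq_one ?_).ge
        obtain ⟨q, hq⟩ := hp.exists_path (e (Sum.inr l))
        refine ⟨q, hq, ?_⟩
        have : e (Sum.inl i) = x := by
          rw [he]
          simp [c, hi]
        rw [this]
        exact q.end_mem_support
      · exact pathMatrix_nonneg _ _
    · exact pathMatrix_nonneg _ _
    · simp only [broomN, of_apply]
      split_ifs with hkl
      · subst hkl
        refine (pathMatrix_eq_one ?_).ge
        obtain ⟨q, hq⟩ := hp.exists_path (e (Sum.inr k))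
        exact ⟨q, hq, q.start_mem_support⟩
      · exact pathMatrix_nonneg _ _
  have h0 : ∀ k a, 0 ≤ broomN d r k a := by
    rintro (i | k) (j | l) <;> simp only [broomN, of_apply] <;>
      first | exact le_rfl | (split_ifs <;> norm_num)
  have : Nonempty (Fin d ⊕ Fin r) := ⟨broomRoot d r hd⟩
  rw [← perronValue_reindex e (bottleneckMatrix T x), hp.bottleneckMatrix_eq, broomM_eq]
  refine perronValue_mono ?_ ?_ (fun a b => ?_) fun a b => ?_
  · rw [Matrix.IsHermitian, conjTranspose_eq_transpose_of_trivial, transpose_mul,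
      transpose_transpose]
  · rw [Matrix.IsHermitian, conjTranspose_eq_transpose_of_trivial, transpose_submatrix,
      transpose_mul, transpose_transpose]
  · rw [Matrix.mul_apply]
    exact Finset.sum_nonneg fun k _ => mul_nonneg (h0 _ _) (h0 _ _)
  · rw [submatrix_apply, Matrix.mul_apply, Matrix.mul_apply, ← Equiv.sum_comp e]
    exact Finset.sum_le_sum fun k _ => mul_le_mul (hle k a) (hle k b) (h0 _ _)
      (pathMatrix_nonneg _ _)

lemma cSeq_lt_perronValue_of_eccent {V : Type*} [Fintype V] [DecidableEq V] {T : SimpleGraph V}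
    {x : V} {d r : ℕ} (hd : 0 < d) (hT : T.IsTree) (hecc : T.eccent x = (d : ℕ∞))
    (hr : r = Fintype.card V - d) :
    cSeq 3 (broomQ d r hd) 1 < perronValue (bottleneckMatrix T x) ∧
      cSeq 3 (broomM d r hd) 1 < perronValue (bottleneckMatrix T x) := by
  have : Nonempty V := ⟨x⟩
  obtain ⟨y, hy⟩ := T.exists_edist_eq_eccent_of_finite x
  obtain ⟨w, hw, hlen⟩ := hT.1.exists_path_of_dist y x
  have hdist : T.dist y x = d := by
    rw [SimpleGraph.dist_comm, SimpleGraph.dist, hy, hecc]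
    rfl
  -- A path of length `d` has `d + 1` vertices, so `n > d`: the subtraction defining `r` is not
  -- truncated, and `r ≥ 1`.
  have hlt := hw.length_lt
  have hle := perronValue_broomM_le (r := r) hT hd w hw (by omega) (by omega)
  have hr0 : 0 < r := by omega
  refine ⟨lt_of_lt_of_le ?_ hle, (cSeq_broomM_lt hd hr0).trans_le hle⟩
  rw [perronValue_broomM_eq_broomQ]
  exact cSeq_broomQ_lt hd hr0

end Broom

end RootedTreeBounds

namespace RootedTreeBounds

/-! ### Sign of the difference of the two quotients -/

section Comparison

noncomputable def crossCoeff₃ (d : ℝ) : ℝ := 2/15*d^5 - 3/4*d^4 + 3/2*d^3 - 5/4*d^2 + 11/30*d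

noncomputable def crossCoeff₂ (d : ℝ) : ℝ :=
  -17/315*d^7 + 31/90*d^6 - 11/18*d^5 + 29/72*d^4 - 191/180*d^3 + 631/360*d^2 + 19/84*d

noncomputable def crossCoeff₁ (d : ℝ) : ℝ :=
  -1/35*d^8 + 2/105*d^7 + 19/60*d^6 - 53/120*d^5 - 3/20*d^4 + 77/120*d^3 - 29/210*d^2 - 23/105*d

noncomputable def crossCoeff₀ (d : ℝ) : ℝ :=
  -2/4725*d^10 - 1/270*d^9 - 5/252*d^8 + 2/315*d^7 + 427/1800*d^6 + 31/180*d^5 - 271/756*d^4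
    - 161/270*d^3 - 4517/12600*d^2 - 11/140*d

/-- The cubic in `r` for which `V₁ U₂ - U₁ V₂ = r * crossCubic`. -/
noncomputable def crossCubic (d r : ℝ) : ℝ :=
  crossCoeff₃ d * r^3 + crossCoeff₂ d * r^2 + crossCoeff₁ d * r + crossCoeff₀ d

/-- The factor `r` appears because `U₁, V₁` agree at `r = 0`, as do `U₂, V₂`. -/
lemma V₁_mul_U₂_sub (d r : ℝ) : V₁ d r * U₂ d r - U₁ d r * V₂ d r = r * crossCubic d r := by
  simp only [V₁, V₂, U₁, U₂, crossCubic, crossCoeff₃, crossCoeff₂, crossCoeff₁, crossCoeff₀]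
  ring

/-- After the shift `d = e + 3` all coefficients have one sign; the same device serves the next four
lemmas. This coefficient vanishes at `d = 1` and `d = 2`. -/
lemma crossCoeff₃_pos {d : ℝ} (hd : 3 ≤ d) : 0 < crossCoeff₃ d := by
  obtain ⟨e, he, rfl⟩ : ∃ e : ℝ, 0 ≤ e ∧ d = e + 3 := ⟨d - 3, by linarith, by ring⟩
  have : crossCoeff₃ (e + 3) = 2/15*e^5 + 5/4*e^4 + 9/2*e^3 + 31/4*e^2 + 191/30*e + 2 := by
    simp only [crossCoeff₃]; ring
  rw [this]; positivity

lemma crossCoeff₁_neg {d : ℝ} (hd : 3 ≤ d) : crossCoeff₁ d < 0 := by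
  obtain ⟨e, he, rfl⟩ : ∃ e : ℝ, 0 ≤ e ∧ d = e + 3 := ⟨d - 3, by linarith, by ring⟩
  have : crossCoeff₁ (e + 3) = -(1/35*e^8 + 2/3*e^7 + 389/60*e^6 + 4121/120*e^5 + 4321/40*e^4
      + 4913/24*e^3 + 187289/840*e^2 + 7187/60*e + 19) := by
    simp only [crossCoeff₁]; ring
  rw [this, neg_lt_zero]; positivity

lemma crossCoeff₀_neg {d : ℝ} (hd : 3 ≤ d) : crossCoeff₀ d < 0 := by
  obtain ⟨e, he, rfl⟩ : ∃ e : ℝ, 0 ≤ e ∧ d = e + 3 := ⟨d - 3, by linarith, by ring⟩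
  have : crossCoeff₀ (e + 3) = -(2/4725*e^10 + 31/1890*e^9 + 367/1260*e^8 + 958/315*e^7
      + 36413/1800*e^6 + 7927/90*e^5 + 1893403/7560*e^4 + 852737/1890*e^3 + 3021031/6300*e^2
      + 27109/105*e + 48) := by
    simp only [crossCoeff₀]; ring
  rw [this, neg_lt_zero]; positivity

/-- The leading terms `2/15 d⁵` and `-17/315 d⁷` of the two top coefficients place the root near
`17/42 d² ≈ 0.405 d²`, which explains the constants `0.4` and `0.42`. -/
lemma crossCubic_left_neg {d : ℝ} (hd : 3 ≤ d) : crossCubic d (0.4 * d^2 - 1) < 0 := by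
  obtain ⟨e, he, rfl⟩ : ∃ e : ℝ, 0 ≤ e ∧ d = e + 3 := ⟨d - 3, by linarith, by ring⟩
  have : crossCubic (e + 3) (0.4 * (e + 3)^2 - 1) = -(4/39375*e^11 + 956/118125*e^10
      + 9979/47250*e^9 + 1871/700*e^8 + 3100889/157500*e^7 + 834853/9000*e^6 + 30793981/105000*e^5
      + 118942399/189000*e^4 + 168078293/189000*e^3 + 13223013/17500*e^2 + 1358426/4375*e
      + 3556/125) := by
    simp only [crossCubic, crossCoeff₃, crossCoeff₂, crossCoeff₁, crossCoeff₀]; ring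
  rw [this, neg_lt_zero]; positivity

lemma crossCubic_right_pos {d : ℝ} (hd : 3 ≤ d) : 0 < crossCubic d (0.42 * d^2 + 2) := by
  obtain ⟨e, he, rfl⟩ : ∃ e : ℝ, 0 ≤ e ∧ d = e + 3 := ⟨d - 3, by linarith, by ring⟩
  have : crossCubic (e + 3) (0.42 * (e + 3)^2 + 2) = 28/78125*e^11 + 2172517/472500000*e^10
      + 43969/2362500*e^9 + 1774709/31500000*e^8 + 11859249/8750000*e^7 + 8284239/500000*e^6
      + 144208831/1406250*e^5 + 35813343589/94500000*e^4 + 41542462159/47250000*e^3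
      + 8294559179/6562500*e^2 + 4572976473/4375000*e + 6178486/15625 := by
    simp only [crossCubic, crossCoeff₃, crossCoeff₂, crossCoeff₁, crossCoeff₀]; ring
  rw [this]; positivity

/-- Factorization of the cubic at a root. -/
lemma sq_mul_crossCubic {d r₀ : ℝ} (h : crossCubic d r₀ = 0) (r : ℝ) :
    r₀^2 * crossCubic d r = (r - r₀) * (crossCoeff₃ d * (r^2 * r₀^2) - crossCoeff₁ d * (r * r₀)
      - crossCoeff₀ d * (r₀ + r)) := by
  -- Subtracting `r²` times the vanishing value cancels the quadratic term, so the sign of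
  -- `crossCoeff₂` plays no role.
  have : r₀^2 * crossCubic d r = r₀^2 * crossCubic d r - r^2 * crossCubic d r₀ := by
    rw [h]; ring
  rw [this]
  simp only [crossCubic]
  ring

lemma U₂_pos {d r : ℝ} (hd : 0 ≤ d) (hr : 0 < r) : 0 < U₂ d r := by
  unfold U₂; positivity

lemma V₂_pos {d r : ℝ} (hd : 0 ≤ d) (hr : 0 < r) : 0 < V₂ d r := by
  unfold V₂; positivity

lemma V_div_sub_U_div {d r : ℝ} (hd : 0 ≤ d) (hr : 0 < r) :
    V₁ d r / V₂ d r - U₁ d r / U₂ d r = r * crossCubic d r / (V₂ d r * U₂ d r) := by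
  rw [div_sub_div _ _ (V₂_pos hd hr).ne' (U₂_pos hd hr).ne', ← V₁_mul_U₂_sub, mul_comm (V₂ d r)]

lemma exists_root_comparison {d : ℝ} (hd : 3 ≤ d) :
    ∃ r₀ : ℝ, r₀ ∈ Set.Ioo (0.4 * d ^ 2 - 1) (0.42 * d ^ 2 + 2) ∧ ∀ r : ℝ, 0 < r →
      (V₁ d r / V₂ d r - U₁ d r / U₂ d r = 0 ↔ r = r₀) ∧
      (r < r₀ → V₁ d r / V₂ d r < U₁ d r / U₂ d r) ∧
      (r₀ < r → U₁ d r / U₂ d r < V₁ d r / V₂ d r) := by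
  have hcont : ContinuousOn (crossCubic d) (Set.Icc (0.4 * d ^ 2 - 1) (0.42 * d ^ 2 + 2)) := by
    unfold crossCubic; fun_prop
  obtain ⟨r₀, hr₀, hroot⟩ := intermediate_value_Ioo (by nlinarith) hcont
    ⟨crossCubic_left_neg hd, crossCubic_right_pos hd⟩
  refine ⟨r₀, hr₀, fun r hr => ?_⟩
  have hr₀pos : 0 < r₀ := by
    have := hr₀.1
    norm_num at this
    nlinarith
  have hd0 : 0 ≤ d := by linarith
  -- The cofactor is positive because the cubic and the two lowest coefficients have signs `+, -,
  -- -`; this makes `r₀` the only positive root.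
  have hfac : 0 < crossCoeff₃ d * (r^2 * r₀^2) - crossCoeff₁ d * (r * r₀)
      - crossCoeff₀ d * (r₀ + r) := by
    have h1 := mul_pos (crossCoeff₃_pos hd) (by positivity : 0 < r^2 * r₀^2)
    have h2 := mul_pos (neg_pos.2 (crossCoeff₁_neg hd)) (by positivity : 0 < r * r₀)
    have h3 := mul_pos (neg_pos.2 (crossCoeff₀_neg hd)) (by positivity : 0 < r₀ + r)
    linarith
  have hden : 0 < V₂ d r * U₂ d r := mul_pos (V₂_pos hd0 hr) (U₂_pos hd0 hr)
  -- The difference of the quotients is `r - r₀` times a positive number, which yields all three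
  -- claims.
  obtain ⟨c, hc, hce⟩ : ∃ c : ℝ, 0 < c ∧ V₁ d r / V₂ d r - U₁ d r / U₂ d r = (r - r₀) * c := by
    refine ⟨r / (V₂ d r * U₂ d r) / r₀^2 * _, mul_pos (by positivity) hfac, ?_⟩
    rw [V_div_sub_U_div hd0 hr, mul_left_comm, ← sq_mul_crossCubic hroot r]
    field_simp
  refine ⟨?_, fun h => ?_, fun h => ?_⟩
  · rw [hce, mul_eq_zero, or_iff_left hc.ne', sub_eq_zero]
  · have := mul_neg_of_neg_of_pos (sub_neg.2 h) hc
    linarith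
  · have := mul_pos (sub_pos.2 h) hc
    linarith

end Comparison

end RootedTreeBounds

theorem mainTheorem10 :
    -- the two lower bounds for a rooted tree whose root has eccentricity `d`
    (∀ (V : Type*) [Fintype V] [DecidableEq V] (T : SimpleGraph V) (x : V) (d r : ℕ)
        (hd : 0 < d), T.IsTree → T.eccent x = (d : ℕ∞) → r = Fintype.card V - d →
      cSeq 3 (broomQ d r hd) 1
          < perronValue (bottleneckMatrix T x) ∧
      cSeq 3 (broomM d r hd) 1
          < perronValue (bottleneckMatrix T x)) ∧
    -- `M₁` and `Q₁` have the same Perron value; the explicit values of the bounds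
    (∀ (d r : ℕ) (hd : 0 < d), 0 < r →
      perronValue (broomM d r hd)
          = perronValue (broomQ d r hd) ∧
      cSeq 3 (broomQ d r hd) 1
          = U₁ d r / U₂ d r ∧
      cSeq 3 (broomM d r hd) 1
          = V₁ d r / V₂ d r) ∧
    -- comparison of the two bounds, as functions of a real variable and for the brooms themselves
    (∀ (d : ℕ) (hd : 0 < d), 3 ≤ d →
      ∃ r₀ : ℝ, r₀ ∈ Set.Ioo (0.4 * (d : ℝ) ^ 2 - 1) (0.42 * (d : ℝ) ^ 2 + 2) ∧
        (∀ r : ℝ, 0 < r →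
          (V₁ d r / V₂ d r
              - U₁ d r / U₂ d r = 0 ↔ r = r₀) ∧
          (r < r₀ → V₁ d r / V₂ d r
              < U₁ d r / U₂ d r) ∧
          (r₀ < r → U₁ d r / U₂ d r
              < V₁ d r / V₂ d r)) ∧
        (∀ r : ℕ, 0 < r →
          ((r : ℝ) < r₀ → cSeq 3 (broomM d r hd) 1
              < cSeq 3 (broomQ d r hd) 1) ∧
          (r₀ < (r : ℝ) → cSeq 3 (broomQ d r hd) 1
              < cSeq 3 (broomM d r hd) 1))) := by
  refine ⟨fun V _ _ T x d r hd hT hecc hr => cSeq_lt_perronValue_of_eccent hd hT hecc hr,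
    fun d r hd _ => ⟨perronValue_broomM_eq_broomQ d r hd, cSeq_broomQ r hd, cSeq_broomM r hd⟩,
    fun d hd h3 => ?_⟩
  obtain ⟨r₀, hr₀, h⟩ := exists_root_comparison (d := (d : ℝ)) (by exact_mod_cast h3)
  refine ⟨r₀, hr₀, h, fun r hr => ?_⟩
  rw [cSeq_broomM r hd, cSeq_broomQ r hd]
  exact (h r (by exact_mod_cast hr)).2
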